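/- Let $E/\mathbb{Q}$ be an elliptic curve. For $n\ge 1$ let $E[n]=\{P\in E(\overline{\mathbb{Q}}) : nP=\mathcal{O}\}$, and let $\mathbb{Q}(E[n])$ be the field obtained from $\mathbb{Q}$ by adjoining the coordinates of all points of $E[n]$; it is a Galois extension of $\mathbb{Q}$, and we call it nilpotent if $\operatorname{Gal}(\mathbb{Q}(E[n])/\mathbb{Q})$ is a nilpotent group. Suppose that $\mathbb{Q}(E[2])/\mathbb{Q}$ is nilpotent. Then at least one of the following two conditions holds: (a) the discriminant of $E$ is a square in $\mathbb{Q}$ and the image of the mod-$2$ representation $\operatorname{Gal}(\overline{\mathbb{Q}}/\mathbb{Q})\to\operatorname{Aut}(E[2])$ has order $3$; (b) $E$ has a rational point of order $2$. If (a) holds, then $\mathbb{Q}(E[2^k])/\mathbb{Q}$ is not nilpotent for any $k\ge 2$. If (b) holds, then $\mathbb{Q}(E[2^k])/\mathbb{Q}$ is nilpotent for all $k\ge 1$. -/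

import Mathlib

namespace NilpotentDivisionField

universe u

open scoped Classical in
/-- `E(k̄)`: the group of points of `E` over the algebraic closure of the base field `k`. -/
abbrev GeomPoint {k : Type u} [Field k] (E : WeierstrassCurve k) : Type u :=
  (WeierstrassCurve.Affine.baseChange E.toAffine (AlgebraicClosure k)).Point

open scoped Classical in
/-- `E[n] = {P ∈ E(k̄) | n P = O}`. -/
noncomputable def torsion {k : Type*} [Field k] (E : WeierstrassCurve k) (n : ℕ) : AddSubgroup (GeomPoint E) where
  carrier := {P | n • P = 0}
  zero_mem' := nsmul_zero n
  add_mem' := by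
    intro P Q hP hQ
    change n • P = 0 at hP
    change n • Q = 0 at hQ
    change n • (P + Q) = 0
    rw [nsmul_add, hP, hQ, add_zero]
  neg_mem' := by
    intro P hP
    change n • P = 0 at hP
    change n • (-P) = 0
    rw [neg_nsmul, hP, neg_zero]

open scoped Classical in
/-- The action of `σ` on `E(k̄)`, by `(x, y) ↦ (σ x, σ y)` and `O ↦ O`. -/
noncomputable def galAct {k : Type*} [Field k] (E : WeierstrassCurve k) (σ : Gal(AlgebraicClosure k/k)) :
    GeomPoint E →+ GeomPoint E :=
  WeierstrassCurve.Affine.Point.map (W' := E.toAffine) σ.toAlgHom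

open scoped Classical in
theorem galAct_mem {k : Type*} [Field k] (E : WeierstrassCurve k) (n : ℕ) (σ : Gal(AlgebraicClosure k/k))
    (P : GeomPoint E) (hP : P ∈ torsion E n) : galAct E σ P ∈ torsion E n := by
  change n • P = 0 at hP
  change n • galAct E σ P = 0
  rw [← map_nsmul, hP, map_zero]

open scoped Classical in
/-- The action of the absolute Galois group of `k` on `E[n]`. -/
noncomputable def torsionAct {k : Type*} [Field k] (E : WeierstrassCurve k) (n : ℕ) :
    Gal(AlgebraicClosure k/k) →* AddMonoid.End (torsion E n) where
  toFun σ := ((galAct E σ).comp (torsion E n).subtype).codRestrict (torsion E n)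
    fun P => galAct_mem E n σ P P.2
  map_one' := by
    ext ⟨P, hP⟩
    cases P <;> rfl
  map_mul' σ τ := by
    ext ⟨P, hP⟩
    cases P <;> rfl

/-- The mod `n` Galois representation, with values in `Aut(E[n])`, without choosing a basis
of `E[n]`. -/
noncomputable def galoisRep {k : Type*} [Field k] (E : WeierstrassCurve k) (n : ℕ) :
    Gal(AlgebraicClosure k/k) →* (AddMonoid.End (torsion E n))ˣ :=
  (torsionAct E n).toHomUnits

/-- The coordinates of the affine points in `E[n]`. -/
def torsionCoords {k : Type*} [Field k] (E : WeierstrassCurve k) (n : ℕ) : Set (AlgebraicClosure k) :=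
  {z | ∃ x y h, WeierstrassCurve.Affine.Point.some x y h ∈ torsion E n ∧ (z = x ∨ z = y)}

/-- The `n`-division field `k(E[n])`. -/
noncomputable def divisionField {k : Type*} [Field k] (E : WeierstrassCurve k) (n : ℕ) :
    IntermediateField k (AlgebraicClosure k) :=
  IntermediateField.adjoin k (torsionCoords E n)

/-- `k(E[n])/k` is a Galois extension. -/
instance divisionField_isGalois {k : Type*} [Field k] [CharZero k] (E : WeierstrassCurve k) (n : ℕ) :
    IsGalois k (divisionField E n) := by
  have hn : Normal k (divisionField E n) := by
    rw [IntermediateField.normal_iff_forall_map_le']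
    intro σ
    rw [divisionField, IntermediateField.adjoin_map]
    apply IntermediateField.adjoin.mono
    rintro _ ⟨z, ⟨x, y, h, hP, hz⟩, rfl⟩
    refine ⟨σ x, σ y, _, galAct_mem E n σ _ hP, ?_⟩
    rcases hz with rfl | rfl
    · exact Or.inl rfl
    · exact Or.inr rfl
  exact ⟨⟩

/-- The Galois extension `K/k` is nilpotent: its Galois group is a nilpotent group. -/
def IsNilpotentExtension {k L : Type*} [Field k] [Field L] [Algebra k L]
    (K : IntermediateField k L) [IsGalois k K] : Prop :=
  Group.IsNilpotent Gal(K/k)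

end NilpotentDivisionField

/-!
Write `f = 4 X ^ 3 + b₂ X ^ 2 + 2 b₄ X + b₆` for the cubic whose roots are the `x`-coordinates of
the points of order two. An automorphism acts trivially on `E[2]` if and only if it fixes the three
roots of `f` (`fixesTorsion_two_iff`), so everything about `E[2]` is read off from the homomorphism
`rootPerm` to the permutations of three letters.

* A nilpotent group of permutations of three letters without a common fixed point is the alternating
  group (`exists_zpowers_eq_of_isNilpotent`). So if `f` has no rational root, the mod `2` image has
  order `3`, and the product of the differences of the roots, whose square is `Δ / 16`, is rational
  (`isSquare_and_card_of_no_root`).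

* If `f` has a rational root, then `σ ^ 2` acts trivially on `E[2]` for each `σ`, and by induction
  `σ ^ (2 ^ m)` acts trivially on `E[2 ^ m]` (`FixesTorsion.pow_two_pow`). As `E[2 ^ m]` is finite,
  the Galois group of its division field is a finite `2`-group
  (`isNilpotentExtension_of_root`).

* Suppose that the mod `2` image has order `3` and that `K = ℚ(E[2 ^ m])` is nilpotent with `m ≥ 2`.
  Complex conjugation `c` has order at most two, so it fixes the roots of `f`, which are thus real,
  say `a > b > c'`. Some automorphism `s` of odd order on `K` permutes the roots cyclically, and it
  commutes with `c` on `K` since their orders there are coprime (`commute_of_coprime_orderOf`). The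
  halves of the point `(a, _)` have `x`-coordinates `a + w` with `w ^ 2 = (a - b) * (a - c')`, so
  `w` lies in `K` (`sqrt_mem_divisionField`), and `w` is real. A power of `s` takes `a` to `b` and `w`
  to a square root of `(b - a) * (b - c') < 0` that is again fixed by `c`, which is absurd
  (`not_isNilpotentExtension_of_card`).
-/

namespace NilpotentDivisionField

/-! ### Nilpotent groups and permutations of three letters -/

/-- By induction on the nilpotency class: modulo the centre `g` and `h` commute, so that
`g * h * g⁻¹ = z * h` with `z` central, and `z` is killed by both orders. -/
theorem commute_of_coprime_orderOf {G : Type*} [Group G] [Group.IsNilpotent G] {g h : G}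
    (hgh : (orderOf g).Coprime (orderOf h)) : Commute g h := by
  suffices H : ∀ g h : G, ∀ m n : ℕ, m.Coprime n → g ^ m = 1 → h ^ n = 1 → Commute g h from
    H g h _ _ hgh (pow_orderOf_eq_one g) (pow_orderOf_eq_one h)
  clear hgh g h
  refine Group.nilpotent_center_quotient_ind
    (P := fun G _ _ => ∀ g h : G, ∀ m n : ℕ, m.Coprime n → g ^ m = 1 → h ^ n = 1 → Commute g h)
    G ?_ ?_
  · intro G _ _ g h m n _ _ _
    exact Subsingleton.elim _ _
  · intro G _ _ ih g h m n hmn hg hh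
    have hq : Commute (g : G ⧸ Subgroup.center G) (h : G ⧸ Subgroup.center G) :=
      ih _ _ m n hmn (by rw [← QuotientGroup.mk_pow, hg]; rfl)
        (by rw [← QuotientGroup.mk_pow, hh]; rfl)
    have hz : g * h * g⁻¹ * h⁻¹ ∈ Subgroup.center G := by
      rw [← QuotientGroup.eq_one_iff]
      simp only [QuotientGroup.mk_mul, QuotientGroup.mk_inv]
      rw [hq.eq]
      group
    set z := g * h * g⁻¹ * h⁻¹ with hzdef
    have hzc : ∀ x : G, Commute z x := fun x => (Subgroup.mem_center_iff.mp hz x).symm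
    have hzh : g * h * g⁻¹ = z * h := by rw [hzdef]; group
    have hzg : h * g * h⁻¹ = z⁻¹ * g := by rw [hzdef]; group
    have hzn : z ^ n = 1 := by
      have h1 : (g * h * g⁻¹) ^ n = 1 := by rw [conj_pow, hh]; group
      rwa [hzh, (hzc h).mul_pow, hh, mul_one] at h1
    have hzm : z ^ m = 1 := by
      have h1 : (h * g * h⁻¹) ^ m = 1 := by rw [conj_pow, hg]; group
      rwa [hzg, (hzc g).inv_left.mul_pow, hg, mul_one, inv_pow, inv_eq_one] at h1
    have hz1 : z = 1 := by
      rw [← orderOf_eq_one_iff]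
      exact Nat.eq_one_of_dvd_coprimes hmn (orderOf_dvd_of_pow_eq_one hzm)
        (orderOf_dvd_of_pow_eq_one hzn)
    rw [hz1, one_mul] at hzh
    exact mul_inv_eq_iff_eq_mul.mp hzh

theorem isNilpotent_range_of_ker_le {A B C : Type*} [Group A] [Group B] [Group C]
    [Group.IsNilpotent B] (f : A →* B) (hf : Function.Surjective f) (g : A →* C)
    (h : f.ker ≤ g.ker) : Group.IsNilpotent g.range := by
  have hr : f.ker ≤ g.rangeRestrict.ker := by rwa [MonoidHom.ker_rangeRestrict]
  refine Group.nilpotent_of_surjective (f.liftOfSurjective hf ⟨g.rangeRestrict, hr⟩) ?_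
  intro y
  obtain ⟨x, rfl⟩ := g.rangeRestrict_surjective y
  exact ⟨f x, MonoidHom.liftOfRightInverse_comp_apply f _ (Function.rightInverse_surjInv hf)
    ⟨g.rangeRestrict, hr⟩ x⟩

open Equiv

theorem perm_three_sq_eq_one_of_fixed (u : Perm (Fin 3)) (i : Fin 3) (h : u i = i) :
    u ^ 2 = 1 := by
  revert u i; decide

theorem perm_three_apply_ne_self (u : Perm (Fin 3)) (h1 : u ≠ 1) (h3 : u ^ 3 = 1) (i : Fin 3) :
    u i ≠ i := by
  revert u i; decide

theorem perm_three_apply_or_apply_apply (u : Perm (Fin 3)) (h : ∀ i, u i ≠ i) {i j : Fin 3}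
    (hij : i ≠ j) : u i = j ∨ u (u i) = j := by
  revert u i j; decide

theorem perm_three_of_cube_eq_one (u : Perm (Fin 3)) (h : u ^ 3 = 1) :
    (u 0 = 0 ∧ u 1 = 1 ∧ u 2 = 2) ∨ (u 0 = 1 ∧ u 1 = 2 ∧ u 2 = 0) ∨
      (u 0 = 2 ∧ u 1 = 0 ∧ u 2 = 1) := by
  revert u; decide

theorem perm_three_orderOf (u : Perm (Fin 3)) (h : ∀ i, u i ≠ i) : orderOf u = 3 := by
  apply orderOf_eq_prime <;> (revert u; decide)

theorem perm_three_cyclic_or_not_commute (u v : Perm (Fin 3)) (h : ∀ i, u i ≠ i) :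
    (v = 1 ∨ v = u ∨ v = u ^ 2) ∨ (v ^ 2 = 1 ∧ v ≠ 1 ∧ u * v ≠ v * u) := by
  revert u v; decide

theorem perm_three_exists_derangement (u v w : Perm (Fin 3)) (hu : u 0 ≠ 0) (hv : v 1 ≠ 1)
    (hw : w 2 ≠ 2) : ∃ t ∈ [u, v, w, u * v, u * w, v * w], ∀ i, t i ≠ i := by
  revert u v w; decide

/-- A nilpotent group of permutations of three letters without a common fixed point is the
alternating group: it contains a `3`-cycle, and a transposition would have to commute with it. -/
theorem exists_zpowers_eq_of_isNilpotent (H : Subgroup (Perm (Fin 3))) [Group.IsNilpotent H]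
    (hH : ∀ i, ∃ u ∈ H, u i ≠ i) :
    ∃ u : Perm (Fin 3), (∀ i, u i ≠ i) ∧ H = Subgroup.zpowers u := by
  obtain ⟨u, hu, hu0⟩ := hH 0
  obtain ⟨v, hv, hv0⟩ := hH 1
  obtain ⟨w, hw, hw0⟩ := hH 2
  obtain ⟨t, ht, htd⟩ := perm_three_exists_derangement u v w hu0 hv0 hw0
  have htH : t ∈ H := by
    simp only [List.mem_cons, List.not_mem_nil, or_false] at ht
    rcases ht with rfl | rfl | rfl | rfl | rfl | rfl
    exacts [hu, hv, hw, mul_mem hu hv, mul_mem hu hw, mul_mem hv hw]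
  refine ⟨t, htd, le_antisymm ?_ (by simpa using htH)⟩
  intro x hx
  rcases perm_three_cyclic_or_not_commute t x htd with (rfl | rfl | rfl) | ⟨hx2, hx1, hxt⟩
  · exact one_mem _
  · exact Subgroup.mem_zpowers x
  · exact pow_mem (Subgroup.mem_zpowers t) 2
  · refine absurd ?_ hxt
    have hc : (orderOf (⟨t, htH⟩ : H)).Coprime (orderOf (⟨x, hx⟩ : H)) := by
      rw [Subgroup.orderOf_mk, Subgroup.orderOf_mk, perm_three_orderOf t htd,
        orderOf_eq_prime hx2 hx1]
      norm_num
    exact congrArg Subtype.val (commute_of_coprime_orderOf hc).eq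

/-! ### Points of order two and their halves -/

section Weierstrass

variable {F : Type*} [Field F] (W : WeierstrassCurve F)

/-- `x` is a root of the `2`-torsion cubic `4 X ^ 3 + b₂ X ^ 2 + 2 b₄ X + b₆`; its roots are the
`x`-coordinates of the points of order two. -/
def IsTwoTorsionRoot (x : F) : Prop :=
  4 * x ^ 3 + W.b₂ * x ^ 2 + 2 * W.b₄ * x + W.b₆ = 0

theorem sq_eq_of_equation {x y : F} (h : W.toAffine.Equation x y) :
    (2 * y + W.a₁ * x + W.a₃) ^ 2 = 4 * x ^ 3 + W.b₂ * x ^ 2 + 2 * W.b₄ * x + W.b₆ := by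
  rw [WeierstrassCurve.Affine.equation_iff] at h
  simp only [WeierstrassCurve.b₂, WeierstrassCurve.b₄, WeierstrassCurve.b₆]
  linear_combination 4 * h

theorem two_nsmul_some_eq_zero_iff [DecidableEq F] {x y : F} (h : W.toAffine.Nonsingular x y) :
    2 • WeierstrassCurve.Affine.Point.some x y h = 0 ↔ 2 * y + W.a₁ * x + W.a₃ = 0 := by
  rw [two_nsmul, add_eq_zero_iff_eq_neg, WeierstrassCurve.Affine.Point.neg_some,
    WeierstrassCurve.Affine.Point.some.injEq]
  simp only [true_and, WeierstrassCurve.Affine.negY]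
  exact ⟨fun h => by linear_combination h, fun h => by linear_combination h⟩

theorem isTwoTorsionRoot_of_two_nsmul [DecidableEq F] {x y : F} (h : W.toAffine.Nonsingular x y)
    (h2 : 2 • WeierstrassCurve.Affine.Point.some x y h = 0) : IsTwoTorsionRoot W x := by
  rw [IsTwoTorsionRoot, ← sq_eq_of_equation W h.1, (two_nsmul_some_eq_zero_iff W h).mp h2]
  ring

/-- Completing the square turns the Weierstrass equation into `z ^ 2 = 4 * x ^ 3 + ⋯` with
`z = 2 * y + a₁ * x + a₃`. -/
theorem nonsingular_of_sq_eq [CharZero F] [W.IsElliptic] {x z : F}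
    (h : z ^ 2 = 4 * x ^ 3 + W.b₂ * x ^ 2 + 2 * W.b₄ * x + W.b₆) :
    W.toAffine.Nonsingular x ((z - W.a₁ * x - W.a₃) / 2) := by
  rw [← WeierstrassCurve.Affine.equation_iff_nonsingular, WeierstrassCurve.Affine.equation_iff]
  simp only [WeierstrassCurve.b₂, WeierstrassCurve.b₄, WeierstrassCurve.b₆] at h
  linear_combination h / 4

theorem exists_addOrderOf_eq_two [CharZero F] [W.IsElliptic] [DecidableEq F] {x : F}
    (hx : IsTwoTorsionRoot W x) :
    ∃ y h, addOrderOf (WeierstrassCurve.Affine.Point.some (W' := W.toAffine) x y h) = 2 := by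
  refine ⟨_, nonsingular_of_sq_eq W (z := 0) (by rw [show _ = (0 : F) from hx]; ring), ?_⟩
  refine addOrderOf_eq_prime ?_ (WeierstrassCurve.Affine.Point.some_ne_zero _)
  rw [two_nsmul_some_eq_zero_iff]
  ring

/-- The relations between the roots and the coefficients of the `2`-torsion cubic, and its
discriminant `16 * Δ` in terms of the roots. -/
theorem exists_roots [CharZero F] [IsAlgClosed F] :
    ∃ e : Fin 3 → F,
      W.b₂ = -4 * (e 0 + e 1 + e 2) ∧ W.b₄ = 2 * (e 0 * e 1 + e 0 * e 2 + e 1 * e 2) ∧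
      W.b₆ = -4 * (e 0 * e 1 * e 2) ∧
      W.Δ = 16 * ((e 0 - e 1) * (e 0 - e 2) * (e 1 - e 2)) ^ 2 := by
  have ha : W.twoTorsionPolynomial.a ≠ 0 := by
    simp [WeierstrassCurve.twoTorsionPolynomial]
  obtain ⟨x, y, z, h⟩ := (Cubic.splits_iff_roots_eq_three (φ := RingHom.id F) ha).mp
    (IsAlgClosed.splits _)
  have hb := Cubic.b_eq_three_roots ha h
  have hc := Cubic.c_eq_three_roots ha h
  have hd := Cubic.d_eq_three_roots ha h
  have hD := Cubic.discr_eq_prod_three_roots ha h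
  rw [W.twoTorsionPolynomial_discr] at hD
  simp only [WeierstrassCurve.twoTorsionPolynomial, RingHom.id_apply] at hb hc hd hD
  refine ⟨![x, y, z], ?_, ?_, ?_, ?_⟩ <;> simp only [Matrix.cons_val]
  · linear_combination hb
  · linear_combination hc / 2
  · linear_combination hd
  · linear_combination hD / 16

/-- If `e, e', e''` are the `x`-coordinates of the points of order two and
`(x - e) ^ 2 = (e - e') * (e - e'')`, then translation by `T = (e, _)` sends `Q = (x, y)` to a
point with the same `x`-coordinate. Hence `Q + T = -Q`, and `Q` has order dividing four. -/
theorem four_nsmul_eq_zero [CharZero F] [DecidableEq F] {e e' e'' x y f : F}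
    (hb : W.b₂ = -4 * (e + e' + e'')) (hb4 : W.b₄ = 2 * (e * e' + e * e'' + e' * e''))
    (hb6 : W.b₆ = -4 * (e * e' * e'')) (hxe : x ≠ e)
    (hx : (x - e) ^ 2 = (e - e') * (e - e''))
    (hT : W.toAffine.Nonsingular e f) (hf : 2 * f + W.a₁ * e + W.a₃ = 0)
    (hQ : W.toAffine.Nonsingular x y) :
    4 • WeierstrassCurve.Affine.Point.some x y hQ = 0 := by
  set Q := WeierstrassCurve.Affine.Point.some x y hQ with hQdef
  set T := WeierstrassCurve.Affine.Point.some e f hT with hTdef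
  have hT2 : 2 • T = 0 := (two_nsmul_some_eq_zero_iff W hT).mpr hf
  have hT0 : T ≠ 0 := WeierstrassCurve.Affine.Point.some_ne_zero _
  have hxe' : x - e ≠ 0 := sub_ne_zero.mpr hxe
  have hsq := sq_eq_of_equation W hQ.1
  have hX : W.toAffine.addX x e (W.toAffine.slope x e y f) = x := by
    rw [WeierstrassCurve.Affine.slope_of_X_ne hxe, WeierstrassCurve.Affine.addX]
    have h4 : (4 : F) ≠ 0 := by norm_num
    -- Clear the denominator of the slope, and complete the square.
    rw [← sub_eq_zero, ← mul_right_inj' (pow_ne_zero 2 hxe'), ← mul_right_inj' h4]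
    have hslope : (y - f) / (x - e) * (x - e) = y - f := div_mul_cancel₀ _ hxe'
    generalize (y - f) / (x - e) = l at hslope ⊢
    have hS : 2 * (l * (x - e)) + W.a₁ * (x - e) = 2 * y + W.a₁ * x + W.a₃ := by
      linear_combination 2 * hslope - hf
    have hb2 : W.a₁ ^ 2 + 4 * W.a₂ = -4 * (e + e' + e'') := hb
    linear_combination (2 * (l * (x - e)) + W.a₁ * (x - e) + (2 * y + W.a₁ * x + W.a₃)) * hS + hsq
      - (x - e) ^ 2 * hb2 + x ^ 2 * hb + 2 * x * hb4 + hb6 - 4 * (x - e) * hx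
  have hsum : Q + T = Q ∨ Q + T = -Q := by
    rw [hQdef, hTdef, WeierstrassCurve.Affine.Point.add_of_X_ne hxe,
      ← WeierstrassCurve.Affine.Point.X_eq_iff]
    exact hX
  rcases hsum with h | h
  · exact absurd (add_eq_left.mp h) hT0
  · have h2 : 2 • Q = -T := by
      rw [two_nsmul, ← sub_eq_zero, sub_neg_eq_add, add_assoc, h, add_neg_cancel]
    rw [show 4 = 2 * 2 from rfl, mul_nsmul, h2, neg_nsmul, hT2, neg_zero]

end Weierstrass

/-! ### The Galois action on torsion points -/

section Galois

variable {k : Type*} [Field k] (E : WeierstrassCurve k)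

/-- The base change of `E` to a field extension `K`. -/
noncomputable abbrev curveOver (K : Type*) [Field K] [Algebra k K] : WeierstrassCurve K :=
  E.map (algebraMap k K)

section Extension

variable {K : Type*} [Field K] [Algebra k K]

theorem isTwoTorsionRoot_algebraMap_iff {x : k} :
    IsTwoTorsionRoot (curveOver E K) (algebraMap k (K) x) ↔
      IsTwoTorsionRoot E x := by
  simp only [IsTwoTorsionRoot, WeierstrassCurve.map_b₂, WeierstrassCurve.map_b₄,
    WeierstrassCurve.map_b₆]
  rw [← (algebraMap k K).injective.eq_iff (b := 0)]
  simp [map_ofNat]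

variable {E} in
theorem IsTwoTorsionRoot.apply {x : K} (hx : IsTwoTorsionRoot (curveOver E K) x)
    (σ : Gal(K/k)) : IsTwoTorsionRoot (curveOver E K) (σ x) := by
  have h := congrArg σ hx
  simpa [IsTwoTorsionRoot, map_ofNat] using h

theorem apply_eq_of_two_mul_eq [CharZero K] {x y : K} (σ : Gal(K/k)) (hx : σ x = x)
    (hy : 2 * y + (curveOver E K).a₁ * x + (curveOver E K).a₃ = 0) : σ y = y := by
  have hσy := congrArg σ hy
  simp only [map_add, map_mul, map_ofNat, map_zero, WeierstrassCurve.map_a₁,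
    WeierstrassCurve.map_a₃, AlgEquiv.commutes, hx] at hσy hy
  have : (2 : K) * (σ y - y) = 0 := by linear_combination hσy - hy
  simpa [sub_eq_zero] using this

/-- The permutation of the `x`-coordinates of the points of order two induced by a Galois
automorphism, transported to `Fin 3` by the numbering `e`. -/
noncomputable def rootPerm (e : Fin 3 ≃ {x // IsTwoTorsionRoot (curveOver E K) x}) :
    Gal(K/k) →* Equiv.Perm (Fin 3) where
  toFun σ := e.trans ((σ.toEquiv.subtypeEquiv fun x =>
    ⟨fun hx => hx.apply σ, fun hx => by simpa using hx.apply σ.symm⟩).trans e.symm)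
  map_one' := by
    ext i
    simp
  map_mul' σ τ := by
    ext i
    simp

variable (e : Fin 3 ≃ {x // IsTwoTorsionRoot (curveOver E K) x})

theorem coe_rootPerm_apply (σ : Gal(K/k)) (i : Fin 3) :
    (e (rootPerm E e σ i) : K) = σ (e i) := by
  simp [rootPerm]

theorem rootPerm_apply_eq_iff (σ : Gal(K/k)) (i j : Fin 3) :
    rootPerm E e σ i = j ↔ σ (e i) = e j := by
  rw [← coe_rootPerm_apply, ← Subtype.ext_iff, e.injective.eq_iff]

end Extension

/-- `σ` fixes every point of `E[n]`. -/
def FixesTorsion (n : ℕ) (σ : Gal(AlgebraicClosure k/k)) : Prop :=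
  ∀ P ∈ torsion E n, galAct E σ P = P

open scoped Classical in
theorem mem_torsion_iff {n : ℕ} {P : GeomPoint E} : P ∈ torsion E n ↔ n • P = 0 :=
  Iff.rfl

theorem galAct_some_eq_self_iff (σ : Gal(AlgebraicClosure k/k)) {x y : AlgebraicClosure k}
    (h : (curveOver E (AlgebraicClosure k)).toAffine.Nonsingular x y) :
    galAct E σ (WeierstrassCurve.Affine.Point.some x y h) =
      WeierstrassCurve.Affine.Point.some x y h ↔ σ x = x ∧ σ y = y := by
  exact (WeierstrassCurve.Affine.Point.some.injEq (σ x) (σ y) _ x y h).to_iff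

theorem galAct_one (P : GeomPoint E) : galAct E 1 P = P := by
  cases P <;> rfl

theorem galAct_mul (σ τ : Gal(AlgebraicClosure k/k)) (P : GeomPoint E) :
    galAct E (σ * τ) P = galAct E σ (galAct E τ P) := by
  cases P <;> rfl

theorem galoisRep_eq_one_iff (n : ℕ) (σ : Gal(AlgebraicClosure k/k)) :
    galoisRep E n σ = 1 ↔ FixesTorsion E n σ := by
  rw [← Units.val_inj]
  constructor
  · intro h P hP
    exact congrArg Subtype.val (DFunLike.congr_fun h (⟨P, hP⟩ : torsion E n))
  · intro h
    refine AddMonoidHom.ext fun P => Subtype.ext ?_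
    exact h P.1 P.2

theorem restrictNormalHom_divisionField_eq_one_iff [CharZero k] (n : ℕ)
    (σ : Gal(AlgebraicClosure k/k)) :
    AlgEquiv.restrictNormalHom (divisionField E n) σ = 1 ↔ FixesTorsion E n σ := by
  rw [show AlgEquiv.restrictNormalHom (divisionField E n) σ =
    AlgEquiv.restrictNormal σ (divisionField E n) from rfl, AlgEquiv.restrictNormal_eq_one_iff]
  constructor
  · rintro h (_ | ⟨x, y, hxy⟩) hP
    · rfl
    · exact (galAct_some_eq_self_iff E σ hxy).mpr
        ⟨h x (IntermediateField.subset_adjoin _ _ ⟨x, y, hxy, hP, Or.inl rfl⟩),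
          h y (IntermediateField.subset_adjoin _ _ ⟨x, y, hxy, hP, Or.inr rfl⟩)⟩
  · intro h z hz
    have hle : divisionField E n ≤ IntermediateField.fixedField (Subgroup.zpowers σ) := by
      rw [divisionField, IntermediateField.adjoin_le_iff]
      rintro z ⟨x, y, hxy, hP, hz⟩
      have hfix := (galAct_some_eq_self_iff E σ hxy).mp (h _ hP)
      have hσz : σ z = z := by rcases hz with rfl | rfl; exacts [hfix.1, hfix.2]
      rw [SetLike.mem_coe, IntermediateField.mem_fixedField_iff]
      intro τ hτ
      have : Subgroup.zpowers σ ≤ MulAction.stabilizer Gal(AlgebraicClosure k/k) z := by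
        rw [Subgroup.zpowers_le]; exact hσz
      exact this hτ
    exact (IntermediateField.mem_fixedField_iff _ _).mp (hle hz) σ (Subgroup.mem_zpowers σ)

variable (e : Fin 3 ≃ {x // IsTwoTorsionRoot (curveOver E (AlgebraicClosure k)) x})

theorem fixesTorsion_two_iff [CharZero k] [E.IsElliptic] (σ : Gal(AlgebraicClosure k/k)) :
    FixesTorsion E 2 σ ↔ rootPerm E e σ = 1 := by
  classical
  constructor
  · intro h
    ext1 i
    rw [rootPerm_apply_eq_iff, Equiv.Perm.one_apply]
    obtain ⟨y, hy, h2⟩ := exists_addOrderOf_eq_two (curveOver E (AlgebraicClosure k)) (e i).2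
    refine ((galAct_some_eq_self_iff E σ hy).mp (h _ ?_)).1
    rw [mem_torsion_iff]
    have := addOrderOf_nsmul_eq_zero (WeierstrassCurve.Affine.Point.some _ y hy)
    rwa [h2] at this
  · rintro h (_ | ⟨x, y, hxy⟩) hP
    · rfl
    · have hx : IsTwoTorsionRoot (curveOver E (AlgebraicClosure k)) x :=
        isTwoTorsionRoot_of_two_nsmul _ hxy hP
      have hy := (two_nsmul_some_eq_zero_iff (curveOver E (AlgebraicClosure k)) hxy).mp hP
      have hσx : σ x = x := by
        have := (rootPerm_apply_eq_iff E e σ (e.symm ⟨x, hx⟩) (e.symm ⟨x, hx⟩)).mp (by rw [h]; rfl)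
        simpa using this
      exact (galAct_some_eq_self_iff E σ hxy).mpr ⟨hσx, apply_eq_of_two_mul_eq E σ hσx hy⟩

theorem exists_rational_root_of_forall_fixed [CharZero k] (i : Fin 3)
    (h : ∀ σ, rootPerm E e σ i = i) : ∃ x : k, IsTwoTorsionRoot E x := by
  obtain ⟨x, hx⟩ := (InfiniteGalois.mem_range_algebraMap_iff_fixed (k := k)
    (e i : AlgebraicClosure k)).mpr fun σ => (rootPerm_apply_eq_iff E e σ i i).mp (h σ)
  refine ⟨x, ?_⟩
  rw [← isTwoTorsionRoot_algebraMap_iff E (K := AlgebraicClosure k), hx]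
  exact (e i).2

theorem ker_galoisRep_two [CharZero k] [E.IsElliptic] :
    (galoisRep E 2).ker = (rootPerm E e).ker := by
  ext σ
  rw [MonoidHom.mem_ker, MonoidHom.mem_ker, galoisRep_eq_one_iff, fixesTorsion_two_iff]

theorem card_range_galoisRep_two [CharZero k] [E.IsElliptic] :
    Nat.card (galoisRep E 2).range = Nat.card (rootPerm E e).range := by
  rw [← Subgroup.index_ker, ← Subgroup.index_ker, ker_galoisRep_two E e]

/-- A numbering of the roots of the `2`-torsion cubic, which are distinct as `Δ ≠ 0`, with the
relations between roots and coefficients. -/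
theorem exists_root_equiv [CharZero k] [E.IsElliptic] :
    ∃ e : Fin 3 ≃ {x // IsTwoTorsionRoot (curveOver E (AlgebraicClosure k)) x},
      (curveOver E (AlgebraicClosure k)).b₂ = -4 * (e 0 + e 1 + e 2 : AlgebraicClosure k) ∧
      (curveOver E (AlgebraicClosure k)).b₄ =
        2 * (e 0 * e 1 + e 0 * e 2 + e 1 * e 2 : AlgebraicClosure k) ∧
      (curveOver E (AlgebraicClosure k)).b₆ = -4 * (e 0 * e 1 * e 2 : AlgebraicClosure k) ∧
      (curveOver E (AlgebraicClosure k)).Δ =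
        16 * ((e 0 - e 1) * (e 0 - e 2) * (e 1 - e 2) : AlgebraicClosure k) ^ 2 := by
  obtain ⟨e, h2, h4, h6, hD⟩ := exists_roots (curveOver E (AlgebraicClosure k))
  have hroot : ∀ x, IsTwoTorsionRoot (curveOver E (AlgebraicClosure k)) x ↔
      4 * ((x - e 0) * (x - e 1) * (x - e 2)) = 0 := by
    intro x
    rw [IsTwoTorsionRoot, h2, h4, h6]
    constructor <;> intro h <;> linear_combination h
  have hD0 : (curveOver E (AlgebraicClosure k)).Δ ≠ 0 :=
    (curveOver E (AlgebraicClosure k)).coe_Δ' ▸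
      (curveOver E (AlgebraicClosure k)).Δ'.ne_zero
  have hne : e 0 ≠ e 1 ∧ e 0 ≠ e 2 ∧ e 1 ≠ e 2 := by
    refine ⟨?_, ?_, ?_⟩ <;> intro h <;> apply hD0 <;> rw [hD, h] <;> ring
  have hinj : Function.Injective e := by
    intro i j hij
    fin_cases i <;> fin_cases j <;> simp_all
  have hmem : ∀ i, IsTwoTorsionRoot (curveOver E (AlgebraicClosure k)) (e i) := by
    intro i
    rw [hroot]
    fin_cases i <;> simp
  refine ⟨Equiv.ofBijective (fun i => ⟨e i, hmem i⟩)
    ⟨fun i j h => hinj (congrArg Subtype.val h), ?_⟩,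
    h2, h4, h6, hD⟩
  rintro ⟨x, hx⟩
  have hx' := (hroot x).mp hx
  simp only [mul_eq_zero, sub_eq_zero, OfNat.ofNat_ne_zero, false_or] at hx'
  rcases hx' with (h | h) | h
  exacts [⟨0, Subtype.ext h.symm⟩, ⟨1, Subtype.ext h.symm⟩, ⟨2, Subtype.ext h.symm⟩]

end Galois

/-! ### Finiteness of the division fields -/

section Finiteness

theorem finiteDimensional_divisionField {k : Type*} [Field k] (E : WeierstrassCurve k)
    {n : ℕ} (h : (torsion E n : Set (GeomPoint E)).Finite) :
    FiniteDimensional k (divisionField E n) := by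
  have hfin : (torsionCoords E n).Finite := by
    refine ((h.image fun P : GeomPoint E => match P with | .zero => 0 | .some x _ _ => x).union
      (h.image fun P : GeomPoint E => match P with | .zero => 0 | .some _ y _ => y)).subset ?_
    rintro z ⟨x, y, hxy, hP, rfl | rfl⟩
    · exact Or.inl ⟨_, hP, rfl⟩
    · exact Or.inr ⟨_, hP, rfl⟩
  have : Finite (torsionCoords E n) := hfin
  exact IntermediateField.finiteDimensional_adjoin
    fun z _ => (Algebra.IsAlgebraic.isAlgebraic z).isIntegral

variable {k : Type*} [Field k] [CharZero k] (E : WeierstrassCurve k) [E.IsElliptic]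

theorem finite_torsion_two : (torsion E 2 : Set (GeomPoint E)).Finite := by
  classical
  obtain ⟨e, -⟩ := exists_root_equiv E
  choose y hy hord using fun i =>
    exists_addOrderOf_eq_two (curveOver E (AlgebraicClosure k)) (e i).2
  refine (Set.finite_range (fun o : Option (Fin 3) =>
    (o.elim 0 fun i => .some (e i : AlgebraicClosure k) (y i) (hy i) : GeomPoint E))).subset ?_
  rintro (_ | ⟨x, z, hxz⟩) hP
  · exact ⟨none, rfl⟩
  · have hx : IsTwoTorsionRoot (curveOver E (AlgebraicClosure k)) x :=
      isTwoTorsionRoot_of_two_nsmul _ hxz hP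
    obtain ⟨i, rfl⟩ : ∃ i, (e i : AlgebraicClosure k) = x := ⟨e.symm ⟨x, hx⟩, by simp⟩
    refine ⟨some i, (WeierstrassCurve.Affine.Point.some.injEq ..).mpr ⟨rfl, ?_⟩⟩
    have h1 := (two_nsmul_some_eq_zero_iff _ (hy i)).mp (hord i ▸ addOrderOf_nsmul_eq_zero _)
    have h2 := (two_nsmul_some_eq_zero_iff (curveOver E (AlgebraicClosure k)) hxz).mp hP
    exact mul_left_cancel₀ (two_ne_zero' (AlgebraicClosure k)) (by linear_combination h1 - h2)

open scoped Classical in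
/-- The fibres of doubling are cosets of the finite group `E[2]`. -/
theorem finite_torsion_two_pow (m : ℕ) : (torsion E (2 ^ m) : Set (GeomPoint E)).Finite := by
  induction m with
  | zero =>
    refine (Set.finite_singleton (0 : GeomPoint E)).subset fun P hP => ?_
    simpa [mem_torsion_iff] using hP
  | succ m ih =>
    have hpre : (torsion E (2 ^ (m + 1)) : Set (GeomPoint E)) =
        (fun P : GeomPoint E => 2 • P) ⁻¹' (torsion E (2 ^ m) : Set (GeomPoint E)) := by
      ext P
      simp only [Set.mem_preimage, SetLike.mem_coe, mem_torsion_iff]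
      rw [← mul_nsmul, pow_succ']
    rw [hpre]
    refine ih.preimage' fun R _ => ?_
    rcases Set.eq_empty_or_nonempty ((fun P : GeomPoint E => 2 • P) ⁻¹' {R}) with h | ⟨Q, hQ⟩
    · rw [h]; exact Set.finite_empty
    · refine ((finite_torsion_two E).image (fun T => Q + T)).subset fun P hP => ?_
      refine ⟨P - Q, ?_, add_sub_cancel Q P⟩
      change 2 • P = R at hP
      change 2 • Q = R at hQ
      rw [SetLike.mem_coe, mem_torsion_iff, nsmul_sub, hP, hQ, sub_self]

end Finiteness

/-! ### Square discriminant or a rational root -/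

section Dichotomy

variable {k : Type*} [Field k] [CharZero k] (E : WeierstrassCurve k) [E.IsElliptic]

/-- If the `2`-torsion cubic has no rational root, the nilpotent group permuting its roots is
alternating and fixes the product of the differences of the roots, a square root of `Δ / 16`. -/
theorem isSquare_and_card_of_no_root (hE : IsNilpotentExtension (divisionField E 2))
    (h : ∀ x : k, ¬ IsTwoTorsionRoot E x) :
    IsSquare E.Δ ∧ Nat.card (galoisRep E 2).range = 3 := by
  obtain ⟨e, -, -, -, hD⟩ := exists_root_equiv E
  have : Group.IsNilpotent Gal(divisionField E 2/k) := hE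
  have hker : (AlgEquiv.restrictNormalHom (K₁ := AlgebraicClosure k) (divisionField E 2)).ker ≤
      (rootPerm E e).ker := by
    intro σ hσ
    rwa [MonoidHom.mem_ker, restrictNormalHom_divisionField_eq_one_iff,
      fixesTorsion_two_iff E e] at hσ
  have : Group.IsNilpotent (rootPerm E e).range :=
    isNilpotent_range_of_ker_le _ (AlgEquiv.restrictNormalHom_surjective _) _ hker
  obtain ⟨u, hu, hH⟩ := exists_zpowers_eq_of_isNilpotent (rootPerm E e).range (by
    intro i
    by_contra! hfix
    obtain ⟨x, hx⟩ := exists_rational_root_of_forall_fixed E e i fun σ => hfix _ ⟨σ, rfl⟩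
    exact h x hx)
  have hcard : Nat.card (rootPerm E e).range = 3 := by
    rw [hH, Nat.card_zpowers, perm_three_orderOf u hu]
  refine ⟨?_, by rw [card_range_galoisRep_two E e, hcard]⟩
  set d : AlgebraicClosure k := (e 0 - e 1) * (e 0 - e 2) * (e 1 - e 2) with hd
  have hfix : ∀ σ : Gal(AlgebraicClosure k/k), σ d = d := by
    intro σ
    have h3 : rootPerm E e σ ^ 3 = 1 := by
      have := pow_card_eq_one' (x := (⟨_, σ, rfl⟩ : (rootPerm E e).range))
      rw [hcard] at this
      exact congrArg Subtype.val this
    simp only [hd, map_mul, map_sub, ← coe_rootPerm_apply]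
    rcases perm_three_of_cube_eq_one _ h3 with ⟨h0, h1, h2⟩ | ⟨h0, h1, h2⟩ | ⟨h0, h1, h2⟩ <;>
      rw [h0, h1, h2] <;> ring
  obtain ⟨q, hq⟩ := (InfiniteGalois.mem_range_algebraMap_iff_fixed (k := k) d).mpr hfix
  refine ⟨4 * q, (algebraMap k (AlgebraicClosure k)).injective ?_⟩
  rw [← WeierstrassCurve.map_Δ, hD, ← hq]
  simp only [map_mul, map_ofNat]
  ring

end Dichotomy

/-! ### A rational point of order two -/

section RationalPoint

variable {k : Type*} [Field k] (E : WeierstrassCurve k)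

theorem galAct_pow_eq_self {σ : Gal(AlgebraicClosure k/k)} {P : GeomPoint E}
    (h : galAct E σ P = P) (n : ℕ) : galAct E (σ ^ n) P = P := by
  induction n with
  | zero => exact galAct_one E P
  | succ n ih => rw [pow_succ, galAct_mul, h, ih]

open scoped Classical in
/-- If `σ` is trivial on `E[2 ^ m]`, where `m ≥ 1`, and `P ∈ E[2 ^ (m + 1)]`, then `D = σ P - P`
lies in `E[2]`, so that `σ D = D` and `σ ^ 2 P = P + 2 D = P`. -/
theorem FixesTorsion.pow_two_pow {σ : Gal(AlgebraicClosure k/k)} (h : FixesTorsion E 2 σ) (m : ℕ) :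
    FixesTorsion E (2 ^ (m + 1)) (σ ^ 2 ^ m) := by
  induction m with
  | zero => simpa using h
  | succ m ih =>
    intro P hP
    set ρ := σ ^ 2 ^ m with hρ
    have h2P : galAct E ρ (2 • P) = 2 • P := by
      apply ih
      rw [mem_torsion_iff] at hP ⊢
      rw [← mul_nsmul, ← pow_succ', hP]
    have hD : galAct E ρ P - P ∈ torsion E 2 := by
      rw [mem_torsion_iff, nsmul_sub, ← map_nsmul, h2P, sub_self]
    have hfix : galAct E ρ (galAct E ρ P - P) = galAct E ρ P - P := by
      rw [hρ]
      exact galAct_pow_eq_self E (h _ hD) _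
    have h2 : 2 • (galAct E ρ P - P) = 0 := hD
    rw [pow_succ, pow_mul, ← hρ, pow_two, galAct_mul]
    rw [map_sub, sub_eq_iff_eq_add] at hfix
    rw [hfix]
    rw [two_nsmul] at h2
    calc galAct E ρ P - P + galAct E ρ P
        = (galAct E ρ P - P + (galAct E ρ P - P)) + P := by abel
      _ = P := by rw [h2, zero_add]

theorem isNilpotentExtension_of_root [CharZero k] [E.IsElliptic] {x : k} (hx : IsTwoTorsionRoot E x)
    (m : ℕ) : IsNilpotentExtension (divisionField E (2 ^ (m + 1))) := by
  obtain ⟨e, -⟩ := exists_root_equiv E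
  have hfin := finiteDimensional_divisionField E (finite_torsion_two_pow E (m + 1))
  have hp : IsPGroup 2 Gal(divisionField E (2 ^ (m + 1))/k) := by
    intro g
    obtain ⟨σ, rfl⟩ := AlgEquiv.restrictNormalHom_surjective (AlgebraicClosure k) g
    refine ⟨m + 1, ?_⟩
    rw [← map_pow, restrictNormalHom_divisionField_eq_one_iff,
      show σ ^ 2 ^ (m + 1) = (σ ^ 2) ^ 2 ^ m by rw [pow_succ', pow_mul]]
    apply FixesTorsion.pow_two_pow
    rw [fixesTorsion_two_iff E e, map_pow]
    apply perm_three_sq_eq_one_of_fixed _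
      (e.symm ⟨_, (isTwoTorsionRoot_algebraMap_iff E (K := AlgebraicClosure k)).mpr hx⟩)
    rw [rootPerm_apply_eq_iff]
    simp
  exact hp.isNilpotent

end RationalPoint

/-! ### Square roots of differences of roots in the fourth division field -/

theorem subset_divisionField_of_dvd {k : Type*} [Field k] (E : WeierstrassCurve k)
    {m n : ℕ} (h : m ∣ n) :
    torsionCoords E m ⊆ divisionField E n := by
  classical
  rintro z ⟨x, y, hxy, hP, hz⟩
  refine IntermediateField.subset_adjoin _ _ ⟨x, y, hxy, ?_, hz⟩
  obtain ⟨c, rfl⟩ := h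
  rw [mem_torsion_iff] at hP ⊢
  rw [mul_nsmul, hP, nsmul_zero]

section FourTorsion

variable {k : Type*} [Field k] [CharZero k] (E : WeierstrassCurve k) [E.IsElliptic]

/-- A point of order two with `x`-coordinate `a` has a half with `x`-coordinate `a + w`, where
`w ^ 2 = (a - b) * (a - c)` and `b, c` are the `x`-coordinates of the other two points. -/
theorem sqrt_mem_divisionField {n : ℕ} (hn : 4 ∣ n) {a b c w : AlgebraicClosure k}
    (h2 : (curveOver E (AlgebraicClosure k)).b₂ = -4 * (a + b + c))
    (h4 : (curveOver E (AlgebraicClosure k)).b₄ = 2 * (a * b + a * c + b * c))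
    (h6 : (curveOver E (AlgebraicClosure k)).b₆ = -4 * (a * b * c))
    (hw : w ^ 2 = (a - b) * (a - c)) : w ∈ divisionField E n := by
  classical
  by_cases hw0 : w = 0
  · rw [hw0]; exact zero_mem _
  have ha : IsTwoTorsionRoot (curveOver E (AlgebraicClosure k)) a := by
    rw [IsTwoTorsionRoot, h2, h4, h6]; ring
  obtain ⟨f, hT, hord⟩ := exists_addOrderOf_eq_two _ ha
  have hT2 : 2 • WeierstrassCurve.Affine.Point.some
      (W' := (curveOver E (AlgebraicClosure k)).toAffine) a f hT = 0 :=
    hord ▸ addOrderOf_nsmul_eq_zero _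
  obtain ⟨z, hz⟩ := IsAlgClosed.exists_pow_nat_eq
    (4 * (a + w) ^ 3 + (curveOver E (AlgebraicClosure k)).b₂ * (a + w) ^ 2 +
      2 * (curveOver E (AlgebraicClosure k)).b₄ * (a + w) +
      (curveOver E (AlgebraicClosure k)).b₆) two_pos
  have hQ := nonsingular_of_sq_eq _ hz
  have hQ4 := four_nsmul_eq_zero (curveOver E (AlgebraicClosure k)) h2 h4 h6
    (by simpa using hw0) (by linear_combination hw) hT
    ((two_nsmul_some_eq_zero_iff _ hT).mp hT2) hQ
  have haK : a ∈ divisionField E n :=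
    subset_divisionField_of_dvd E (dvd_trans (by norm_num) hn) ⟨a, f, hT, hT2, Or.inl rfl⟩
  have hxK : a + w ∈ divisionField E n :=
    subset_divisionField_of_dvd E hn ⟨_, _, hQ, hQ4, Or.inl rfl⟩
  simpa using sub_mem hxK haK

end FourTorsion

/-! ### Complex conjugation -/

/-- Complex conjugation on the algebraic closure of a field `k` with a real embedding. -/
theorem exists_conj (k : Type*) [Field k] [CharZero k] [Algebra k ℝ] :
    ∃ (φ : AlgebraicClosure k →+* ℂ) (c : Gal(AlgebraicClosure k/k)),
      ∀ z, φ (c z) = starRingEnd ℂ (φ z) := by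
  let φ : AlgebraicClosure k →ₐ[k] ℂ := IsAlgClosed.lift
  let : Algebra (AlgebraicClosure k) ℂ := φ.toRingHom.toAlgebra
  have : IsScalarTower k (AlgebraicClosure k) ℂ := IsScalarTower.of_algHom φ
  exact ⟨φ, (Complex.conjAe.restrictScalars k).restrictNormal (AlgebraicClosure k),
    fun z => AlgEquiv.restrictNormal_commutes (Complex.conjAe.restrictScalars k) _ z⟩

theorem conj_eq_self_iff_of_sq_eq {z : ℂ} {t : ℝ} (h : z ^ 2 = t) :
    starRingEnd ℂ z = z ↔ 0 ≤ t := by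
  constructor
  · intro hz
    obtain ⟨r, rfl⟩ := Complex.conj_eq_iff_real.mp hz
    have : r ^ 2 = t := by exact_mod_cast h
    rw [← this]; positivity
  · intro ht
    have hs : z ^ 2 = ((√t : ℝ) : ℂ) ^ 2 := by
      rw [h, ← Complex.ofReal_pow, Real.sq_sqrt ht]
    rcases sq_eq_sq_iff_eq_or_eq_neg.mp hs with h | h <;> rw [h] <;> simp

theorem exists_sorted (r : Fin 3 → ℝ) (hr : Function.Injective r) :
    ∃ i j l : Fin 3, r j < r i ∧ r l < r j := by
  have h01 := hr.ne (show (0 : Fin 3) ≠ 1 by decide)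
  have h02 := hr.ne (show (0 : Fin 3) ≠ 2 by decide)
  have h12 := hr.ne (show (1 : Fin 3) ≠ 2 by decide)
  rcases lt_or_gt_of_ne h01 with a | a <;> rcases lt_or_gt_of_ne h02 with b | b <;>
    rcases lt_or_gt_of_ne h12 with c | c
  exacts [⟨2, 1, 0, c, a⟩, ⟨1, 2, 0, c, b⟩, ⟨2, 1, 0, c, a⟩, ⟨1, 0, 2, a, b⟩,
    ⟨2, 0, 1, b, a⟩, ⟨0, 1, 2, a, c⟩, ⟨0, 2, 1, b, c⟩, ⟨0, 1, 2, a, c⟩]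

theorem fin_three_cases {i j l : Fin 3} (hij : i ≠ j) (hil : i ≠ l) (hjl : j ≠ l) :
    (i = 0 ∧ j = 1 ∧ l = 2) ∨ (i = 0 ∧ j = 2 ∧ l = 1) ∨ (i = 1 ∧ j = 0 ∧ l = 2) ∨
      (i = 1 ∧ j = 2 ∧ l = 0) ∨ (i = 2 ∧ j = 0 ∧ l = 1) ∨ (i = 2 ∧ j = 1 ∧ l = 0) := by
  revert i j l; decide

theorem perm_three_apply_of_apply (u : Equiv.Perm (Fin 3)) {i j l : Fin 3} (hij : i ≠ j)
    (hil : i ≠ l) (hjl : j ≠ l) (h : u i = j) : (u j = i ∧ u l = l) ∨ (u j = l ∧ u l = i) := by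
  revert u i j l; decide

/-- Let `a > b > c` be the roots of the `2`-torsion cubic, all fixed by complex conjugation.
The field contains a real number `w` with `w ^ 2 = (a - b) * (a - c)`. An automorphism that
commutes with complex conjugation and maps `a` to `b` would map `w` to a real square root of
`(b - a) * (b - c) < 0`; in a nilpotent group, an automorphism of odd order permuting the roots
cyclically, or its square, is of this kind. -/
theorem not_isNilpotentExtension_of_card {k : Type*} [Field k] [CharZero k]
    [Algebra k ℝ] (E : WeierstrassCurve k) [E.IsElliptic]
    (hcard : Nat.card (galoisRep E 2).range = 3) {m : ℕ} (hm : 2 ≤ m) :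
    ¬ IsNilpotentExtension (divisionField E (2 ^ m)) := by
  intro hK
  have : Group.IsNilpotent Gal(divisionField E (2 ^ m)/k) := hK
  have hfin := finiteDimensional_divisionField E (finite_torsion_two_pow E m)
  obtain ⟨e, h2, h4, h6, -⟩ := exists_root_equiv E
  rw [card_range_galoisRep_two E e] at hcard
  set π := rootPerm E e with hπ
  have hnormal : Normal k (divisionField E (2 ^ m)) := (divisionField_isGalois E _).to_normal
  set res := AlgEquiv.restrictNormalHom (F := k) (K₁ := AlgebraicClosure k)
    (divisionField E (2 ^ m)) with hres
  have hcube : ∀ σ, π σ ^ 3 = 1 := by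
    intro σ
    have := pow_card_eq_one' (x := (⟨_, σ, rfl⟩ : π.range))
    rw [hcard] at this
    exact congrArg Subtype.val this
  have eq_one_of_pow : ∀ σ n, Nat.Coprime 3 n → π σ ^ n = 1 → π σ = 1 := by
    intro σ n hn h
    rw [← orderOf_eq_one_iff]
    exact Nat.eq_one_of_dvd_coprimes hn (orderOf_dvd_of_pow_eq_one (hcube σ))
      (orderOf_dvd_of_pow_eq_one h)
  obtain ⟨φ, c, hφc⟩ := exists_conj k
  have hc2 : c ^ 2 = 1 := by
    ext z
    apply φ.injective
    rw [pow_two, AlgEquiv.mul_apply, hφc, hφc, Complex.conj_conj, AlgEquiv.one_apply]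
  have hπc : π c = 1 := eq_one_of_pow c 2 (by norm_num) (by rw [← map_pow, hc2, map_one])
  -- If `σ` moves the roots, so does `s = σ ^ 2 ^ a`, where `2 ^ a` is the `2`-part of the order of
  -- `σ` on the division field: the order of `s` there is odd, and that of `c` divides two.
  obtain ⟨s, hπs, hcomm⟩ : ∃ s, π s ≠ 1 ∧ Commute (res c) (res s) := by
    obtain ⟨σ, hσ⟩ : ∃ σ, π σ ≠ 1 := by
      by_contra! h
      have : π.range = ⊥ := by
        rw [eq_bot_iff]; rintro _ ⟨σ, rfl⟩; exact h σ
      rw [this] at hcard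
      simp at hcard
    obtain ⟨a, b, hb, hab⟩ := Nat.exists_eq_two_pow_mul_odd (orderOf_pos (res σ)).ne'
    refine ⟨σ ^ 2 ^ a, fun h => hσ (eq_one_of_pow σ (2 ^ a)
      (Nat.Coprime.pow_right a (by norm_num)) (by rwa [map_pow] at h)), ?_⟩
    apply commute_of_coprime_orderOf
    have h1 : orderOf (res c) ∣ 2 := orderOf_dvd_of_pow_eq_one (by rw [← map_pow, hc2, map_one])
    have h3 : orderOf (res (σ ^ 2 ^ a)) ∣ b := orderOf_dvd_of_pow_eq_one (by
      rw [map_pow, ← pow_mul, ← hab, pow_orderOf_eq_one])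
    exact Nat.Coprime.of_dvd h1 h3 (Nat.coprime_two_left.mpr hb)
  have hreal : ∀ i, φ (e i) = ((φ (e i)).re : ℂ) := by
    intro i
    have h := (rootPerm_apply_eq_iff E e c i i).mp (by rw [← hπ, hπc]; rfl)
    have h' := hφc (e i)
    rw [h] at h'
    exact (Complex.conj_eq_iff_re.mp h'.symm).symm
  set r : Fin 3 → ℝ := fun i => (φ (e i)).re with hr
  have hrinj : Function.Injective r := by
    intro i j hij
    apply e.injective
    apply Subtype.ext
    apply φ.injective
    rw [hreal i, hreal j]
    exact congrArg _ hij
  have fixed_iff : ∀ {w : AlgebraicClosure k} {i j l : Fin 3},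
      w ^ 2 = (e i - e j) * (e i - e l) → (c w = w ↔ 0 ≤ (r i - r j) * (r i - r l)) := by
    intro w i j l hw
    rw [← φ.injective.eq_iff, hφc]
    apply conj_eq_self_iff_of_sq_eq
    rw [← map_pow, hw, map_mul, map_sub, map_sub, hreal i, hreal j, hreal l]
    push_cast
    rfl
  obtain ⟨i, j, l, hji, hlj⟩ := exists_sorted r hrinj
  have hij : i ≠ j := by rintro rfl; exact lt_irrefl _ hji
  have hjl : j ≠ l := by rintro rfl; exact lt_irrefl _ hlj
  have hil : i ≠ l := by rintro rfl; exact lt_irrefl _ (hji.trans hlj)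
  obtain ⟨w, hw⟩ := IsAlgClosed.exists_pow_nat_eq
    ((e i - e j) * (e i - e l) : AlgebraicClosure k) two_pos
  have hwK : w ∈ divisionField E (2 ^ m) := by
    refine sqrt_mem_divisionField E (pow_dvd_pow 2 hm) ?_ ?_ ?_ hw <;>
      rcases fin_three_cases hij hil hjl with ⟨rfl, rfl, rfl⟩ | ⟨rfl, rfl, rfl⟩ | ⟨rfl, rfl, rfl⟩ |
        ⟨rfl, rfl, rfl⟩ | ⟨rfl, rfl, rfl⟩ | ⟨rfl, rfl, rfl⟩ <;>
      first | rw [h2] | rw [h4] | rw [h6]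
    all_goals ring
  have hcw : c w = w := (fixed_iff hw).mpr
    (mul_nonneg (sub_nonneg.mpr hji.le) (sub_nonneg.mpr (hlj.trans hji).le))
  obtain ⟨τ, hτ, hcτ⟩ : ∃ τ, π τ i = j ∧ Commute (res c) (res τ) := by
    rcases perm_three_apply_or_apply_apply (π s)
      (perm_three_apply_ne_self _ hπs (hcube s)) hij with h | h
    · exact ⟨s, h, hcomm⟩
    · refine ⟨s * s, ?_, ?_⟩
      · rw [map_mul, Equiv.Perm.mul_apply, h]
      · rw [map_mul]; exact hcomm.mul_right hcomm
  have hcτw : c (τ w) = τ w := by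
    have h : res (c * τ) = res (τ * c) := by rw [map_mul, map_mul, hcτ.eq]
    have h' := congrArg Subtype.val (DFunLike.congr_fun h ⟨w, hwK⟩)
    rw [hres, AlgEquiv.restrictNormalHom_apply, AlgEquiv.restrictNormalHom_apply,
      AlgEquiv.mul_apply, AlgEquiv.mul_apply] at h'
    rw [h', hcw]
  have hτw : (τ w) ^ 2 = (e j - e i) * (e j - e l) := by
    rw [← map_pow, hw, map_mul, map_sub, map_sub]
    simp only [← coe_rootPerm_apply, ← hπ, hτ]
    rcases perm_three_apply_of_apply (π τ) hij hil hjl hτ with ⟨ha, hb⟩ | ⟨ha, hb⟩ <;>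
      rw [ha, hb]
    ring
  have hneg : (r j - r i) * (r j - r l) < 0 :=
    mul_neg_of_neg_of_pos (sub_neg.mpr hji) (sub_pos.mpr hlj)
  exact absurd ((fixed_iff hτw).mp hcτw) (not_le.mpr hneg)

end NilpotentDivisionField

open NilpotentDivisionField in
theorem mainTheorem7 (E : WeierstrassCurve ℚ) [E.IsElliptic]
    (hE : IsNilpotentExtension (divisionField E 2)) :
    ((IsSquare E.Δ ∧ Nat.card (galoisRep E 2).range = 3) ∨
      (∃ P : E.toAffine.Point, addOrderOf P = 2)) ∧
    ((IsSquare E.Δ ∧ Nat.card (galoisRep E 2).range = 3) →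
      ∀ k : ℕ, 2 ≤ k → ¬ IsNilpotentExtension (divisionField E (2 ^ k))) ∧
    ((∃ P : E.toAffine.Point, addOrderOf P = 2) →
      ∀ k : ℕ, 1 ≤ k → IsNilpotentExtension (divisionField E (2 ^ k))) := by
  refine ⟨?_, fun h k hk => not_isNilpotentExtension_of_card E h.2 hk, ?_⟩
  · by_cases h : ∃ x : ℚ, IsTwoTorsionRoot E x
    · obtain ⟨x, hx⟩ := h
      obtain ⟨y, hxy, hP⟩ := exists_addOrderOf_eq_two E hx
      exact Or.inr ⟨_, hP⟩
    · exact Or.inl (isSquare_and_card_of_no_root E hE (not_exists.mp h))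
  · rintro ⟨P, hP⟩ k hk
    obtain ⟨m, rfl⟩ := Nat.exists_eq_add_of_le' hk
    rcases P with _ | ⟨x, y, hxy⟩
    · exact absurd (hP.symm.trans addOrderOf_zero) (by norm_num)
    · exact isNilpotentExtension_of_root E
        (isTwoTorsionRoot_of_two_nsmul E hxy (hP ▸ addOrderOf_nsmul_eq_zero _)) m
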